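/- **Setting.** Let $K\ge 1$. A bandit instance is a vector $\mu\in\mathbb R^K$ with a unique largest entry; after relabelling, this is $\mu_1$ (the agent does not know which arm is optimal). Put $\Delta_i:=\mu_1-\mu_i$ and let $\mathcal U$ be the set of all such instances. In each round $t=1,2,\dots$ the agent chooses, possibly at random and depending on the whole record $(A_s,B_s,X_s)_{s<t}$, an arm $A_t\in\{1,\dots,K\}$ and whether to abstain ($B_t=1$) or not ($B_t=0$). In either case it then observes $X_t$, which given the past and $(A_t,B_t)$ has law $\mathcal N(\mu_{A_t},1)$. If it abstains its reward is the constant $c\in\mathbb R$, otherwise it is $X_t$. An algorithm $\pi$ may use $c$ and the horizon $T$ as inputs; $\Pi^{\mathrm{RW}}$ is the set of all algorithms. The regret is $$R^{\mathrm{RW}}_{\mu,c}(T,\pi):=T\,(\mu_1\vee c)-\mathbb E\Big[\sum_{t=1}^T\big(X_t\mathbf 1\{B_t=0\}+c\,\mathbf 1\{B_t=1\}\big)\Big].$$ An algorithm $\pi$ is $R^{\mathrm{RW}}$-consistent if $R^{\mathrm{RW}}_{\mu,c}(T,\pi)=o(T^a)$ as $T\to\infty$ for all $c\in\mathbb R$,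 $\mu\in\mathcal U$ and $a>0$. **Theorem.** (1) For every $c\in\mathbb R$, every $\mu\in\mathcal U$ and every $R^{\mathrm{RW}}$-consistent algorithm $\pi$, $$\liminf_{T\to\infty}\frac{R^{\mathrm{RW}}_{\mu,c}(T,\pi)}{\log T}\ \ge\ 2\sum_{i>1}\frac{\mu_1\vee c-\mu_i\vee c}{\Delta_i^2}.$$ (2) There is a universal constant $\alpha>0$ (independent of $K$, $c$, $T$) such that for all $K\ge1$, $c\in\mathbb R$ and $T\ge K$, $$\inf_{\pi\in\Pi^{\mathrm{RW}}}\ \sup_{\mu\in\mathcal U}R^{\mathrm{RW}}_{\mu,c}(T,\pi)\ \ge\ \alpha\sqrt{KT}.$$ Moreover, every algorithm $\pi$ has regret at least $\alpha\sqrt{KT}$ on some instance $\mu\in\mathcal U$ with $|\mu_i-c|\le 2$ for all $i$. -/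

import Mathlib

open MeasureTheory ProbabilityTheory Filter Asymptotics

namespace AbstentionBandit

/-- The record `((A, B), X)` of one round: the arm `A`, the abstention decision `B`
(`true` means that the agent abstains) and the observed sample `X`. -/
abbrev Round (K : ℕ) : Type := (Fin K × Bool) × ℝ

/-- A (possibly randomized) policy. Given the full record of the first `t` rounds, the Markov
kernel `rule t` is the joint conditional law of the arm and the abstention decision of the next
round. A decision that is a measurable function of the record is the case of a Dirac kernel. -/
structure Policy (K : ℕ) where
  rule : (t : ℕ) → Kernel (Fin t → Round K) (Fin K × Bool)
  markov : ∀ t, IsMarkovKernel (rule t)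

instance {K : ℕ} (p : Policy K) (t : ℕ) : IsMarkovKernel (p.rule t) := p.markov t

/-- An online algorithm for the fixed-reward setting: the abstention reward `c` and the horizon `T`
are inputs known to the agent, and for each of them the algorithm runs a policy. An anytime
algorithm is one that does not depend on `T`. -/
abbrev Algorithm (K : ℕ) : Type := ℝ → ℕ → Policy K

/-- The law `N(μ a, 1)` of a sample from arm `a`, as a kernel. -/
noncomputable def sampleKernel {K : ℕ} (μ : Fin K → ℝ) : Kernel (Fin K) ℝ where
  toFun a := gaussianReal (μ a) 1
  measurable' := measurable_of_finite _

instance {K : ℕ} (μ : Fin K → ℝ) : IsMarkovKernel (sampleKernel μ) :=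
  ⟨fun a => inferInstanceAs (IsProbabilityMeasure (gaussianReal (μ a) 1))⟩

/-- One round of interaction: given the record of the past, draw `(A, B)` from the policy, then
draw `X` from `N(μ A, 1)`, whether or not the agent abstains. -/
noncomputable def stepKernel {K : ℕ} (p : Policy K) (μ : Fin K → ℝ) (t : ℕ) :
    Kernel (Fin t → Round K) (Round K) :=
  (p.rule t) ⊗ₖ
    ((sampleKernel μ).comap (fun q : (Fin t → Round K) × (Fin K × Bool) => q.2.1)
      (by fun_prop))

instance {K : ℕ} (p : Policy K) (μ : Fin K → ℝ) (t : ℕ) : IsMarkovKernel (stepKernel p μ t) := by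
  unfold stepKernel; infer_instance

/-- Appending one round to a record of `t` rounds. -/
def append {K : ℕ} (t : ℕ) (q : (Fin t → Round K) × Round K) : Fin (t + 1) → Round K :=
  Fin.snoc (α := fun _ => Round K) q.1 q.2

theorem measurable_append {K : ℕ} (t : ℕ) : Measurable (append (K := K) t) := by
  refine measurable_pi_lambda _ fun i => ?_
  refine Fin.lastCases ?_ (fun j => ?_) i
  · simpa [append] using measurable_snd
  · simpa [append, Function.comp_def] using
      (measurable_pi_apply (X := fun _ : Fin t => Round K) j).comp measurable_fst

/-- The joint law of the first `T` rounds `(A₁, B₁, X₁), …, (A_T, B_T, X_T)` when the policy `p`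
interacts with the bandit instance `μ`. -/
noncomputable def law {K : ℕ} (p : Policy K) (μ : Fin K → ℝ) :
    (T : ℕ) → Measure (Fin T → Round K)
  | 0 => Measure.dirac Fin.elim0
  | T + 1 => ((law p μ T) ⊗ₘ (stepKernel p μ T)).map (append T)

instance isProbabilityMeasure_law {K : ℕ} (p : Policy K) (μ : Fin K → ℝ) (T : ℕ) :
    IsProbabilityMeasure (law p μ T) := by
  induction T with
  | zero => unfold law; infer_instance
  | succ T ih =>
    unfold law
    exact Measure.isProbabilityMeasure_map (measurable_append T).aemeasurable

/-- The bandit instances: the vectors of means with a unique optimal arm. The optimal arm may carry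
any label. -/
def Instances (K : ℕ) : Set (Fin K → ℝ) := {μ | ∃ i, ∀ j, j ≠ i → μ j < μ i}

/-- The mean of the optimal arm. -/
noncomputable def bestMean {K : ℕ} (μ : Fin K → ℝ) : ℝ := ⨆ i, μ i

/-- The suboptimality gap of arm `i`. -/
noncomputable def gap {K : ℕ} (μ : Fin K → ℝ) (i : Fin K) : ℝ := bestMean μ - μ i

/-- The reward collected in one round with abstention reward `c`: it is `c` if the agent abstains
and the sample otherwise. -/
noncomputable def reward {K : ℕ} (c : ℝ) (r : Round K) : ℝ := if r.1.2 = true then c else r.2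

/-- The expected cumulative regret over `T` rounds in the fixed-reward setting. -/
noncomputable def regretRW {K : ℕ} (μ : Fin K → ℝ) (c : ℝ) (T : ℕ) (π : Algorithm K) : ℝ :=
  T * max (bestMean μ) c - ∫ ω, ∑ t, reward c (ω t) ∂(law (π c T) μ T)

/-- Consistency in the fixed-reward setting: subpolynomial regret for all abstention rewards and all
bandit instances. -/
def IsConsistentRW {K : ℕ} (π : Algorithm K) : Prop :=
  ∀ c : ℝ, ∀ μ ∈ Instances K, ∀ a : ℝ, 0 < a →
    (fun T : ℕ => regretRW μ c T π) =o[atTop] (fun T : ℕ => (T : ℝ) ^ a)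

end AbstentionBandit

namespace AbstentionBandit

/-! ### Law of the interaction and change of measure. -/

section Interaction

variable {K : ℕ}

/-! Both bounds compare an instance `μ` with an instance `μ'` obtained by changing the mean of a
single arm `i`. Samples are observed even when abstaining, so the divergence between the two laws is
`(μ' i - μ i) ^ 2 / 2` times the expected number of all pulls of `i` (`integrable_logLik`). If every
decision costs at least `δ` under one of the two instances, `bretagnolle_huber` shows that few pulls
of `i` force a large regret under one of them (`two_point_bound`).

Minimax: under `μ` all arms lie below `c` at scale `√(K / T)`, so not abstaining is costly; under
`μ'` an arm pulled at most `T / K` times in expectation is raised above `c`, so abstaining is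
costly. The conflict is about abstention, hence already present for `K = 1`.

Asymptotics: when the best mean exceeds `c`, a suboptimal arm is raised just above it. Consistency
under both instances forces about `2 log T / gap ^ 2` pulls of that arm (`eventually_le_expPulls`),
each costing at least the numerator of its term, with or without abstention. When the best mean is
at most `c`, the bound is zero. -/

theorem lintegral_gaussianReal_change_mean (m m' : ℝ) {f : ℝ → ENNReal} (hf : Measurable f) :
    ∫⁻ x, f x ∂gaussianReal m' 1 =
      ∫⁻ x, f x * ENNReal.ofReal (Real.exp ((m' - m) * (x - m) - (m' - m) ^ 2 / 2))
        ∂gaussianReal m 1 := by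
  rw [gaussianReal_of_var_ne_zero _ one_ne_zero, gaussianReal_of_var_ne_zero _ one_ne_zero,
    lintegral_withDensity_eq_lintegral_mul _ (measurable_gaussianPDF _ _) hf,
    lintegral_withDensity_eq_lintegral_mul _ (measurable_gaussianPDF _ _) (by fun_prop)]
  refine lintegral_congr fun x => ?_
  simp only [Pi.mul_apply, gaussianPDF, gaussianPDFReal]
  rw [mul_comm (f x), ← mul_assoc, ← ENNReal.ofReal_mul (by positivity), mul_assoc _ (Real.exp _),
    ← Real.exp_add]
  congr 4
  simp only [NNReal.coe_one]
  ring

theorem measurable_append_apply {T : ℕ} (h : Fin T → Round K) :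
    Measurable fun r : Round K => append T (h, r) :=
  (measurable_append T).comp measurable_prodMk_left

theorem lintegral_law_succ (p : Policy K) (μ : Fin K → ℝ) (T : ℕ)
    {f : (Fin (T + 1) → Round K) → ENNReal} (hf : Measurable f) :
    ∫⁻ ω, f ω ∂law p μ (T + 1) =
      ∫⁻ h, ∫⁻ d, ∫⁻ x, f (append T (h, (d, x))) ∂gaussianReal (μ d.1) 1 ∂p.rule T h
        ∂law p μ T := by
  rw [law, lintegral_map hf (measurable_append T),
    Measure.lintegral_compProd (f := fun q => f (append T q)) (hf.comp (measurable_append T))]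
  refine lintegral_congr fun h => ?_
  rw [stepKernel, Kernel.lintegral_compProd (f := fun r => f (append T (h, r))) _ _ _
    (hf.comp (measurable_append_apply h))]
  rfl

theorem measurePreserving_init (p : Policy K) (μ : Fin K → ℝ) (T : ℕ) :
    MeasurePreserving (fun (ω : Fin (T + 1) → Round K) (t : Fin T) => ω t.castSucc)
      (law p μ (T + 1)) (law p μ T) := by
  have hm : Measurable fun (ω : Fin (T + 1) → Round K) (t : Fin T) => ω t.castSucc := by fun_prop
  refine ⟨hm, ?_⟩
  rw [law, Measure.map_map hm (measurable_append T)]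
  have : (fun (ω : Fin (T + 1) → Round K) (t : Fin T) => ω t.castSucc) ∘ append T = Prod.fst := by
    ext q t <;> simp [append]
  rw [this]
  exact Measure.fst_compProd _ _

/-- The log-likelihood ratio of a record between the instances `μ'` and `μ`. -/
noncomputable def logLik (μ μ' : Fin K → ℝ) {T : ℕ} (ω : Fin T → Round K) : ℝ :=
  ∑ t, ((μ' (ω t).1.1 - μ (ω t).1.1) * ((ω t).2 - μ (ω t).1.1)
    - (μ' (ω t).1.1 - μ (ω t).1.1) ^ 2 / 2)

theorem measurable_decision {T : ℕ} (φ : Fin K × Bool → ℝ) (t : Fin T) :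
    Measurable fun ω : Fin T → Round K => φ (ω t).1 :=
  (measurable_of_finite φ).comp (measurable_fst.comp (measurable_pi_apply t))

theorem measurable_logLik (μ μ' : Fin K → ℝ) (T : ℕ) :
    Measurable fun ω : Fin T → Round K => logLik μ μ' ω := by
  have h1 := measurable_decision (T := T) fun d : Fin K × Bool => μ d.1
  have h2 := measurable_decision (T := T) fun d : Fin K × Bool => μ' d.1
  unfold logLik
  refine Finset.measurable_sum _ fun t _ => ?_
  have h3 : Measurable fun ω : Fin T → Round K => (ω t).2 := by fun_prop
  exact (((h2 t).sub (h1 t)).mul (h3.sub (h1 t))).sub ((((h2 t).sub (h1 t)).pow_const 2).div_const 2)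

/-- The decision kernels do not depend on the instance, so they cancel and each round contributes
only the ratio of two Gaussian densities. -/
theorem lintegral_law_change_instance (p : Policy K) (μ μ' : Fin K → ℝ) (T : ℕ)
    {f : (Fin T → Round K) → ENNReal} (hf : Measurable f) :
    ∫⁻ ω, f ω ∂law p μ' T =
      ∫⁻ ω, f ω * ENNReal.ofReal (Real.exp (logLik μ μ' ω)) ∂law p μ T := by
  induction T with
  | zero => simp [law, logLik]
  | succ T ih =>
    have hF : Measurable fun ω : Fin (T + 1) → Round K =>
        f ω * ENNReal.ofReal (Real.exp (logLik μ μ' ω)) :=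
      hf.mul (measurable_logLik μ μ' (T + 1)).exp.ennreal_ofReal
    rw [lintegral_law_succ p μ' T hf, lintegral_law_succ p μ T hF, ih]
    · refine lintegral_congr fun h => ?_
      -- The likelihood of the past is constant in the last round, so it moves inside before the
      -- mean of the last sample is changed.
      rw [← lintegral_mul_const' _ _ ENNReal.ofReal_ne_top]
      refine lintegral_congr fun d => ?_
      rw [← lintegral_mul_const' _ _ ENNReal.ofReal_ne_top,
        lintegral_gaussianReal_change_mean (μ d.1) (μ' d.1)
          (f := fun x => f (append T (h, (d, x))) * ENNReal.ofReal (Real.exp (logLik μ μ' h)))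
          ((hf.comp ((measurable_append_apply h).comp measurable_prodMk_left)).mul_const _)]
      refine lintegral_congr fun x => ?_
      rw [mul_assoc, ← ENNReal.ofReal_mul (Real.exp_pos _).le, ← Real.exp_add]
      congr 3
      simp only [logLik, append, Fin.sum_univ_castSucc, Fin.snoc_castSucc, Fin.snoc_last]
    · have h1 : Measurable fun q : (Fin T → Round K) × Round K => f (append T q) :=
        hf.comp (measurable_append T)
      have h2 := h1.lintegral_kernel_prod_right' (κ := stepKernel p μ' T)
      refine (congrArg Measurable (funext fun h => ?_)).mp h2
      rw [stepKernel, Kernel.lintegral_compProd (f := fun r => f (append T (h, r))) _ _ _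
        (hf.comp (measurable_append_apply h))]
      rfl

/-- Centred noise, weighted by the decisions, has mean zero. -/
theorem integrable_noise (p : Policy K) (μ : Fin K → ℝ) (β : Fin K × Bool → ℝ) (T : ℕ) :
    Integrable (fun ω => ∑ t, β (ω t).1 * ((ω t).2 - μ (ω t).1.1)) (law p μ T) ∧
      ∫ ω, ∑ t, β (ω t).1 * ((ω t).2 - μ (ω t).1.1) ∂law p μ T = 0 := by
  induction T with
  | zero => simp
  | succ T ih =>
    have hmp := measurePreserving_init p μ T
    have hg : Measurable fun r : Round K => β r.1 * (r.2 - μ r.1.1) :=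
      ((measurable_of_finite β).comp measurable_fst).mul
        (measurable_snd.sub ((measurable_of_finite fun d : Fin K × Bool => μ d.1).comp
          measurable_fst))
    have hlast : Measurable fun ω : Fin (T + 1) → Round K => ω (Fin.last T) :=
      measurable_pi_apply _
    have hid : ∀ d : Fin K × Bool, Integrable (fun x : ℝ => x) (gaussianReal (μ d.1) 1) :=
      fun d => (memLp_id_gaussianReal 1).integrable le_rfl
    have hnoise : ∀ d : Fin K × Bool,
        Integrable (fun x => β d * (x - μ d.1)) (gaussianReal (μ d.1) 1) :=
      fun d => ((hid d).sub (integrable_const _)).const_mul _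
    have hi1 : Integrable (fun ω : Fin (T + 1) → Round K => ∑ t : Fin T,
        β (ω t.castSucc).1 * ((ω t.castSucc).2 - μ (ω t.castSucc).1.1)) (law p μ (T + 1)) :=
      hmp.integrable_comp_of_integrable ih.1
    have hint : Integrable (fun ω => β (ω (Fin.last T)).1 *
        ((ω (Fin.last T)).2 - μ (ω (Fin.last T)).1.1)) (law p μ (T + 1)) := by
      have hG : Measurable fun ω : Fin (T + 1) → Round K => β (ω (Fin.last T)).1 *
        ((ω (Fin.last T)).2 - μ (ω (Fin.last T)).1.1) := hg.comp hlast
      refine ⟨hG.aestronglyMeasurable, ?_⟩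
      rw [hasFiniteIntegral_iff_enorm, lintegral_law_succ p μ T hG.enorm]
      simp only [append, Fin.snoc_last]
      have hfin : ∀ d : Fin K × Bool,
          ∫⁻ x, ‖β d * (x - μ d.1)‖ₑ ∂gaussianReal (μ d.1) 1 < ⊤ :=
        fun d => (hnoise d).2
      -- There are finitely many decisions, so the largest first absolute moment bounds uniformly in
      -- the past.
      refine lt_of_le_of_lt (lintegral_mono fun h => lintegral_mono fun d =>
        Finset.le_sup (f := fun d : Fin K × Bool =>
          ∫⁻ x, ‖β d * (x - μ d.1)‖ₑ ∂gaussianReal (μ d.1) 1) (Finset.mem_univ d)) ?_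
      simp only [lintegral_const, measure_univ, mul_one]
      exact (Finset.sup_lt_iff ENNReal.zero_lt_top).2 fun d _ => hfin d
    have hz : ∫ ω, β (ω (Fin.last T)).1 *
        ((ω (Fin.last T)).2 - μ (ω (Fin.last T)).1.1) ∂law p μ (T + 1) = 0 := by
      have hG : Measurable fun ω : Fin (T + 1) → Round K => β (ω (Fin.last T)).1 *
        ((ω (Fin.last T)).2 - μ (ω (Fin.last T)).1.1) := hg.comp hlast
      rw [law, integrable_map_measure hG.aestronglyMeasurable
        (measurable_append T).aemeasurable] at hint
      rw [law, integral_map (measurable_append T).aemeasurable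
        hG.aestronglyMeasurable]
      simp only [append, Fin.snoc_last, Function.comp_def] at hint ⊢
      rw [Measure.integral_compProd hint]
      refine integral_eq_zero_of_ae (ae_of_all _ fun h => ?_)
      have hstep : Integrable (fun r : Round K => β r.1 * (r.2 - μ r.1.1)) (stepKernel p μ T h) :=
        (ProbabilityTheory.integrable_compProd_iff hg.aestronglyMeasurable).2
          ⟨ae_of_all _ hnoise, Integrable.of_finite⟩
      simp only [Pi.zero_apply]
      rw [stepKernel] at hstep ⊢
      rw [ProbabilityTheory.integral_compProd hstep]
      refine integral_eq_zero_of_ae (ae_of_all _ fun d => ?_)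
      change ∫ x, β d * (x - μ d.1) ∂gaussianReal (μ d.1) 1 = 0
      rw [integral_const_mul, integral_sub (hid d) (integrable_const _), integral_id_gaussianReal]
      simp
    simp only [Fin.sum_univ_castSucc]
    refine ⟨hi1.add hint, ?_⟩
    rw [integral_add hi1 hint, hz, add_zero]
    rw [← hmp.map_eq, integral_map hmp.measurable.aemeasurable
      ih.1.aestronglyMeasurable] at ih
    exact ih.2

end Interaction

/-! ### The testing inequality. -/

/-- A Bretagnolle-Huber inequality for two probability measures with log-likelihood ratio `ℓ`. -/
theorem bretagnolle_huber {Ω : Type*} [MeasurableSpace Ω] (P Q : Measure Ω)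
    [IsProbabilityMeasure P] [IsProbabilityMeasure Q] {ℓ : Ω → ℝ} (hℓ : Measurable ℓ)
    (hi : Integrable ℓ P) (hQ : Q = P.withDensity fun ω => ENNReal.ofReal (Real.exp (ℓ ω)))
    {s : Set Ω} (hs : MeasurableSet s) :
    Real.exp (∫ ω, ℓ ω ∂P) / 2 ≤ P.real s + Q.real sᶜ := by
  have hexp : Integrable (fun ω => Real.exp (ℓ ω)) P ∧ ∫ ω, Real.exp (ℓ ω) ∂P = 1 := by
    have h1 : ∫⁻ ω, ENNReal.ofReal (Real.exp (ℓ ω)) ∂P = 1 := by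
      have := measure_univ (μ := Q)
      rwa [hQ, withDensity_apply _ MeasurableSet.univ, setLIntegral_univ] at this
    have hI : Integrable (fun ω => Real.exp (ℓ ω)) P := by
      refine ⟨hℓ.exp.aestronglyMeasurable, ?_⟩
      rw [hasFiniteIntegral_iff_ofReal (ae_of_all _ fun ω => (Real.exp_pos _).le), h1]
      exact ENNReal.one_lt_top
    refine ⟨hI, ?_⟩
    rw [integral_eq_lintegral_of_nonneg_ae (ae_of_all _ fun ω => (Real.exp_pos _).le)
      hI.aestronglyMeasurable, h1, ENNReal.toReal_one]
  have hQs : Q.real sᶜ = ∫ ω, sᶜ.indicator (fun ω => Real.exp (ℓ ω)) ω ∂P := by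
    rw [integral_indicator hs.compl, Measure.real, hQ, withDensity_apply _ hs.compl,
      integral_eq_lintegral_of_nonneg_ae (ae_of_all _ fun ω => (Real.exp_pos _).le)
        hℓ.exp.aestronglyMeasurable]
  have hPs : P.real s = ∫ ω, s.indicator (fun _ => (1 : ℝ)) ω ∂P := by
    rw [integral_indicator hs]; simp
  set I := ∫ ω, ℓ ω ∂P with hIdef
  -- AM-GM with weight `lam`, and the tangent line of `exp` at the mean
  set m := Real.exp (I / 2) with hm
  have hmpos : 0 < m := Real.exp_pos _
  have key : ∀ ω, m * (m * (1 + (ℓ ω - I) / 2)) - (1 + Real.exp (ℓ ω)) * (m ^ 2 / 4) ≤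
      s.indicator (fun _ => (1 : ℝ)) ω + sᶜ.indicator (fun ω => Real.exp (ℓ ω)) ω := by
    intro ω
    have hsq : Real.exp (ℓ ω) = Real.exp (ℓ ω / 2) ^ 2 := by
      rw [← Real.exp_nat_mul]; congr 1; push_cast; ring
    have htan : m * (1 + (ℓ ω - I) / 2) ≤ Real.exp (ℓ ω / 2) := by
      have h2 : Real.exp (ℓ ω / 2) = m * Real.exp ((ℓ ω - I) / 2) := by
        rw [hm, ← Real.exp_add]; congr 1; ring
      rw [h2]
      have := Real.add_one_le_exp ((ℓ ω - I) / 2)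
      exact mul_le_mul_of_nonneg_left (by linarith) hmpos.le
    set u := Real.exp (ℓ ω / 2)
    have h3 : m * (m * (1 + (ℓ ω - I) / 2)) - (1 + Real.exp (ℓ ω)) * (m ^ 2 / 4)
        ≤ m * u - (1 + u ^ 2) * m ^ 2 / 4 := by
      rw [hsq]
      have := mul_le_mul_of_nonneg_left htan hmpos.le
      linarith
    refine h3.trans ?_
    -- The right side is `1` or `u ^ 2`; the squares `(m * u / 2 - 1) ^ 2` and `(m / 2 - u) ^ 2`
    -- settle the two cases.
    by_cases hω : ω ∈ s
    · rw [Set.indicator_of_mem hω, Set.indicator_of_notMem (by simpa using hω)]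
      nlinarith [sq_nonneg (m * u / 2 - 1), sq_nonneg m]
    · rw [Set.indicator_of_notMem hω, Set.indicator_of_mem (by simpa using hω), hsq]
      nlinarith [sq_nonneg (m / 2 - u), sq_nonneg (m * u)]
  have hdev : Integrable (fun ω => (ℓ ω - I) / 2) P := (hi.sub (integrable_const I)).div_const 2
  have hi1 : Integrable (fun ω => m * (m * (1 + (ℓ ω - I) / 2))) P :=
    (((integrable_const 1).add hdev).const_mul m).const_mul _
  have hi2 : Integrable (fun ω => (1 + Real.exp (ℓ ω)) * (m ^ 2 / 4)) P :=
    ((integrable_const 1).add hexp.1).mul_const _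
  have hi3 : Integrable (s.indicator fun _ => (1 : ℝ)) P := (integrable_const 1).indicator hs
  have hi4 : Integrable (sᶜ.indicator fun ω => Real.exp (ℓ ω)) P := hexp.1.indicator hs.compl
  have hmono := integral_mono (hi1.sub hi2) (hi3.add hi4) key
  simp only [Pi.sub_apply, Pi.add_apply] at hmono
  rw [integral_sub hi1 hi2, integral_add hi3 hi4, ← hPs, ← hQs] at hmono
  -- The deviation `ℓ - I` has mean zero and `exp ℓ` has mean one, so the left side is `m ^ 2 - 2 *
  -- (m ^ 2 / 4) = exp I / 2`.
  refine le_trans (le_of_eq ?_) hmono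
  rw [integral_const_mul, integral_const_mul, integral_mul_const,
    integral_add (integrable_const _) hdev,
    integral_add (integrable_const _) hexp.1, hexp.2, integral_div,
    integral_sub hi (integrable_const I)]
  have hI2 : Real.exp I = m ^ 2 := by
    rw [hm, ← Real.exp_nat_mul]; congr 1; push_cast; ring
  simp only [integral_const, probReal_univ, one_smul]
  rw [hI2, ← hIdef]
  ring

/-! ### Regret as an expected sum over decisions. -/

section Regret

variable {K : ℕ}

/-- The loss of the decision `d` in one round, given the decision. -/
noncomputable def roundRegret (μ : Fin K → ℝ) (c : ℝ) (d : Fin K × Bool) : ℝ :=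
  max (bestMean μ) c - if d.2 = true then c else μ d.1

/-- The expected sum of `φ` over the decisions of the first `T` rounds. -/
noncomputable def expSum (p : Policy K) (μ : Fin K → ℝ) (T : ℕ) (φ : Fin K × Bool → ℝ) : ℝ :=
  ∫ ω, ∑ t, φ (ω t).1 ∂law p μ T

theorem integrable_sum_decision (p : Policy K) (μ : Fin K → ℝ) (T : ℕ) (φ : Fin K × Bool → ℝ) :
    Integrable (fun ω => ∑ t, φ (ω t).1) (law p μ T) := by
  refine integrable_finsetSum _ fun t _ => ?_
  refine Integrable.of_bound (C := ∑ d, ‖φ d‖) (measurable_decision φ t).aestronglyMeasurable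
    (ae_of_all _ fun ω => ?_)
  exact Finset.single_le_sum (f := fun d => ‖φ d‖) (fun d _ => norm_nonneg _) (Finset.mem_univ _)

theorem expSum_mono (p : Policy K) (μ : Fin K → ℝ) (T : ℕ) {φ ψ : Fin K × Bool → ℝ}
    (h : ∀ d, φ d ≤ ψ d) : expSum p μ T φ ≤ expSum p μ T ψ :=
  integral_mono (integrable_sum_decision p μ T φ) (integrable_sum_decision p μ T ψ)
    fun _ => Finset.sum_le_sum fun _ _ => h _

theorem expSum_const_mul (p : Policy K) (μ : Fin K → ℝ) (T : ℕ) (a : ℝ) (φ : Fin K × Bool → ℝ) :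
    expSum p μ T (fun d => a * φ d) = a * expSum p μ T φ := by
  simp only [expSum, ← Finset.mul_sum, integral_const_mul]

theorem expSum_const (p : Policy K) (μ : Fin K → ℝ) (T : ℕ) (a : ℝ) :
    expSum p μ T (fun _ => a) = T * a := by
  simp [expSum]

theorem expSum_sum (p : Policy K) (μ : Fin K → ℝ) (T : ℕ) {ι : Type*} (s : Finset ι)
    (φ : ι → Fin K × Bool → ℝ) :
    expSum p μ T (fun d => ∑ i ∈ s, φ i d) = ∑ i ∈ s, expSum p μ T (φ i) := by
  unfold expSum
  rw [← integral_finsetSum _ fun i _ => integrable_sum_decision p μ T (φ i)]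
  refine integral_congr_ae (ae_of_all _ fun ω => Finset.sum_comm)

theorem expSum_nonneg (p : Policy K) (μ : Fin K → ℝ) (T : ℕ) {φ : Fin K × Bool → ℝ}
    (h : ∀ d, 0 ≤ φ d) : 0 ≤ expSum p μ T φ :=
  integral_nonneg fun _ => Finset.sum_nonneg fun _ _ => h _

/-- The expected number of pulls of arm `i`, with or without abstention. -/
noncomputable def expPulls (p : Policy K) (μ : Fin K → ℝ) (T : ℕ) (i : Fin K) : ℝ :=
  expSum p μ T fun d => if d.1 = i then 1 else 0

theorem sum_expPulls (p : Policy K) (μ : Fin K → ℝ) (T : ℕ) :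
    ∑ i, expPulls p μ T i = T := by
  unfold expPulls
  rw [← expSum_sum]
  simp [expSum_const]

/-- A reward differs from its mean given the decision by centred noise with weight `0` or `1`, which
vanishes in expectation. -/
theorem regretRW_eq_expSum (μ : Fin K → ℝ) (c : ℝ) (T : ℕ) (π : Algorithm K) :
    regretRW μ c T π = expSum (π c T) μ T (roundRegret μ c) := by
  obtain ⟨hi, hz⟩ := integrable_noise (π c T) μ (fun d => if d.2 = true then 0 else 1) T
  have hd := integrable_sum_decision (π c T) μ T fun d => if d.2 = true then c else μ d.1
  have h1 : ∀ ω : Fin T → Round K, ∑ t, reward c (ω t) =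
      ∑ t, (if (ω t).1.2 = true then c else μ (ω t).1.1) +
        ∑ t, (if (ω t).1.2 = true then 0 else 1) * ((ω t).2 - μ (ω t).1.1) := by
    intro ω
    rw [← Finset.sum_add_distrib]
    refine Finset.sum_congr rfl fun t _ => ?_
    unfold reward
    split_ifs <;> ring
  have h2 : ∀ ω : Fin T → Round K, ∑ t, roundRegret μ c (ω t).1 = T * max (bestMean μ) c -
      ∑ t, (if (ω t).1.2 = true then c else μ (ω t).1.1) := by
    intro ω
    simp [roundRegret, Finset.sum_sub_distrib]
  rw [regretRW, expSum, integral_congr_ae (ae_of_all _ h1), integral_congr_ae (ae_of_all _ h2),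
    integral_add hd hi, hz, add_zero, integral_sub (integrable_const _) hd]
  simp

theorem le_bestMean (μ : Fin K → ℝ) (i : Fin K) : μ i ≤ bestMean μ :=
  le_ciSup (Set.finite_range μ).bddAbove i

theorem bestMean_eq {μ : Fin K → ℝ} {i : Fin K} (h : ∀ j, j ≠ i → μ j < μ i) :
    bestMean μ = μ i := by
  have : Nonempty (Fin K) := ⟨i⟩
  refine le_antisymm (ciSup_le fun j => ?_) (le_bestMean μ i)
  by_cases hj : j = i
  · rw [hj]
  · exact (h j hj).le

theorem sub_max_le_roundRegret (μ : Fin K → ℝ) (c : ℝ) (d : Fin K × Bool) :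
    max (bestMean μ) c - max (μ d.1) c ≤ roundRegret μ c d := by
  unfold roundRegret
  split_ifs
  · linarith [le_max_right (μ d.1) c]
  · linarith [le_max_left (μ d.1) c]

theorem sub_max_nonneg (μ : Fin K → ℝ) (c : ℝ) (i : Fin K) :
    0 ≤ max (bestMean μ) c - max (μ i) c :=
  sub_nonneg.2 (max_le_max_right c (le_bestMean μ i))

theorem roundRegret_nonneg (μ : Fin K → ℝ) (c : ℝ) (d : Fin K × Bool) : 0 ≤ roundRegret μ c d :=
  (sub_max_nonneg μ c d.1).trans (sub_max_le_roundRegret μ c d)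

theorem regretRW_nonneg (μ : Fin K → ℝ) (c : ℝ) (T : ℕ) (π : Algorithm K) :
    0 ≤ regretRW μ c T π := by
  rw [regretRW_eq_expSum]
  exact expSum_nonneg _ _ _ (roundRegret_nonneg μ c)

/-- The regret is at least the weighted number of pulls of the arms. -/
theorem sum_expPulls_le_regretRW (μ : Fin K → ℝ) (c : ℝ) (T : ℕ) (π : Algorithm K) :
    ∑ i, (max (bestMean μ) c - max (μ i) c) * expPulls (π c T) μ T i ≤ regretRW μ c T π := by
  rw [regretRW_eq_expSum]
  simp only [expPulls, ← expSum_const_mul]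
  rw [← expSum_sum]
  refine expSum_mono _ _ _ fun d => ?_
  simpa using sub_max_le_roundRegret μ c d

/-! ### Comparison of two instances. -/

/-- The divergence decomposition for instances that differ in one arm only. -/
theorem integrable_logLik (p : Policy K) {μ μ' : Fin K → ℝ} {i : Fin K}
    (h : ∀ j, j ≠ i → μ' j = μ j) (T : ℕ) :
    Integrable (fun ω => logLik μ μ' ω) (law p μ T) ∧
      ∫ ω, logLik μ μ' ω ∂law p μ T = -((μ' i - μ i) ^ 2 / 2 * expPulls p μ T i) := by
  obtain ⟨hi, hz⟩ := integrable_noise p μ (fun d => μ' d.1 - μ d.1) T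
  have hd := integrable_sum_decision p μ T fun d => (μ' d.1 - μ d.1) ^ 2 / 2
  simp only [logLik, Finset.sum_sub_distrib]
  refine ⟨hi.sub hd, ?_⟩
  rw [integral_sub hi hd, hz, zero_sub, expPulls, ← expSum_const_mul]
  congr 2
  funext ω
  refine Finset.sum_congr rfl fun t _ => ?_
  by_cases ht : (ω t).1.1 = i
  · simp [ht]
  · simp [ht, h _ ht]

theorem law_eq_withDensity (p : Policy K) (μ μ' : Fin K → ℝ) (T : ℕ) :
    law p μ' T =
      (law p μ T).withDensity fun ω => ENNReal.ofReal (Real.exp (logLik μ μ' ω)) := by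
  ext s hs
  rw [withDensity_apply _ hs, ← lintegral_indicator_one hs,
    lintegral_law_change_instance p μ μ' T (measurable_one.indicator hs), ← lintegral_indicator hs]
  refine lintegral_congr fun ω => ?_
  by_cases hω : ω ∈ s <;> simp [hω]

/-- A Markov inequality: the rounds with a costly decision. -/
theorem mul_measureReal_le_regretRW (μ : Fin K → ℝ) (c : ℝ) (T : ℕ) (π : Algorithm K) {δ : ℝ}
    (hδ : 0 ≤ δ) (S : Set (Fin K × Bool)) (hS : ∀ d ∈ S, δ ≤ roundRegret μ c d)
    {s : Set (Fin T → Round K)}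
    (hs : ∀ ω ∈ s, (T : ℝ) / 2 ≤ ∑ t, S.indicator (fun _ => (1 : ℝ)) (ω t).1)
    (hsm : MeasurableSet s) :
    δ * (T / 2) * (law (π c T) μ T).real s ≤ regretRW μ c T π := by
  have h1 : (T : ℝ) / 2 * (law (π c T) μ T).real s ≤
      expSum (π c T) μ T (S.indicator fun _ => 1) := by
    have : (T : ℝ) / 2 * (law (π c T) μ T).real s =
        ∫ ω, s.indicator (fun _ => (T : ℝ) / 2) ω ∂law (π c T) μ T := by
      rw [integral_indicator hsm]; simp [mul_comm]
    rw [this, expSum]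
    refine integral_mono ((integrable_const _).indicator hsm)
      (integrable_sum_decision _ _ _ _) fun ω => ?_
    refine Set.indicator_le' (fun ω hω => hs ω hω) (fun ω _ => ?_) ω
    exact Finset.sum_nonneg fun t _ => Set.indicator_nonneg (fun _ _ => zero_le_one) _
  rw [mul_assoc, regretRW_eq_expSum]
  refine (mul_le_mul_of_nonneg_left h1 hδ).trans ?_
  rw [← expSum_const_mul]
  refine expSum_mono _ _ _ fun d => ?_
  by_cases hd : d ∈ S
  · simpa [hd] using hS d hd
  · simpa [hd] using roundRegret_nonneg μ c d

/-- Two instances that differ in one arm cannot both have small regret if no decision is good for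
both. -/
theorem two_point_bound {μ μ' : Fin K → ℝ} {i : Fin K} (h : ∀ j, j ≠ i → μ' j = μ j) (c : ℝ)
    (T : ℕ) (π : Algorithm K) {δ : ℝ} (hδ : 0 ≤ δ) (S : Set (Fin K × Bool))
    (hS : ∀ d ∈ S, δ ≤ roundRegret μ c d) (hS' : ∀ d ∉ S, δ ≤ roundRegret μ' c d) :
    δ * T / 4 * Real.exp (-((μ' i - μ i) ^ 2 / 2 * expPulls (π c T) μ T i)) ≤
      regretRW μ c T π + regretRW μ' c T π := by
  set s : Set (Fin T → Round K) :=
    {ω | (T : ℝ) / 2 ≤ ∑ t, S.indicator (fun _ => (1 : ℝ)) (ω t).1} with hsdef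
  have hs : MeasurableSet s := measurableSet_le measurable_const
    (Finset.measurable_sum _ fun t _ => measurable_decision _ t)
  obtain ⟨hi, hv⟩ := integrable_logLik (π c T) h T
  have hbh := bretagnolle_huber (law (π c T) μ T) (law (π c T) μ' T) (measurable_logLik μ μ' T) hi
    (law_eq_withDensity (π c T) μ μ' T) hs
  rw [hv] at hbh
  have h1 := mul_measureReal_le_regretRW μ c T π hδ S hS (s := s) (fun ω hω => hω) hs
  have h2 := mul_measureReal_le_regretRW μ' c T π hδ Sᶜ hS' (s := sᶜ) (fun ω hω => by
    have hsum : ∑ t, S.indicator (fun _ => (1 : ℝ)) (ω t).1 +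
        ∑ t, Sᶜ.indicator (fun _ => (1 : ℝ)) (ω t).1 = T := by
      rw [← Finset.sum_add_distrib]
      simp [Set.indicator_self_add_compl_apply]
    have : ¬ (T : ℝ) / 2 ≤ ∑ t, S.indicator (fun _ => (1 : ℝ)) (ω t).1 := hω
    linarith) hs.compl
  have h3 := mul_le_mul_of_nonneg_left hbh (by positivity : 0 ≤ δ * (T / 2))
  linarith

/-! ### Minimax bound. -/

/-- The minimax lower bound. -/
theorem exists_le_regretRW [NeZero K] (c : ℝ) {T : ℕ} (hKT : K ≤ T) (π : Algorithm K) :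
    ∃ μ ∈ Instances K, (∀ i, |μ i - c| ≤ 2) ∧
      Real.exp (-(9 / 2)) / 8 * √((K : ℝ) * T) ≤ regretRW μ c T π := by
  have hK : (0 : ℝ) < K := Nat.cast_pos.2 (NeZero.pos K)
  have hKT' : (K : ℝ) ≤ T := Nat.cast_le.2 hKT
  have hT : (0 : ℝ) < T := hK.trans_le hKT'
  -- This scale makes `Δ ^ 2 * (T / K) = 1`, so the divergence stays bounded; `K ≤ T` gives `Δ ≤ 1`,
  -- which keeps all means within `2` of `c`.
  set Δ : ℝ := √(K / T) with hΔdef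
  have hΔ : 0 < Δ := Real.sqrt_pos.2 (div_pos hK hT)
  have hΔ1 : Δ ≤ 1 := Real.sqrt_le_one.2 ((div_le_one hT).2 hKT')
  have hΔsq : Δ ^ 2 = K / T := Real.sq_sqrt (div_pos hK hT).le
  have hΔT : Δ * T = √(K * T) := by
    rw [eq_comm, Real.sqrt_eq_iff_eq_sq (by positivity) (by positivity), mul_pow, hΔsq]
    field_simp
  -- The two levels serve only to make the best arm unique.
  set μ : Fin K → ℝ := fun j => if j = 0 then c - Δ else c - 2 * Δ with hμ
  have hμlt : ∀ j, μ j ≤ c - Δ := fun j => by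
    simp only [hμ]; split_ifs <;> linarith
  have hμgt : ∀ j, c - 2 * Δ ≤ μ j := fun j => by
    simp only [hμ]; split_ifs <;> linarith
  obtain ⟨i, hi⟩ : ∃ i, expPulls (π c T) μ T i ≤ T / K := by
    by_contra! hcon
    have h1 := Finset.sum_lt_sum_of_nonempty (s := Finset.univ) Finset.univ_nonempty
      fun i _ => hcon i
    rw [sum_expPulls] at h1
    simp [mul_div_cancel₀, hK.ne'] at h1
  set μ' : Fin K → ℝ := Function.update μ i (c + Δ) with hμ'
  have hμ'i : μ' i = c + Δ := Function.update_self ..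
  have hμ'j : ∀ j, j ≠ i → μ' j = μ j := fun j hj => Function.update_of_ne hj ..
  have hbest' : ∀ j, j ≠ i → μ' j < μ' i := fun j hj => by
    rw [hμ'j j hj, hμ'i]; linarith [hμlt j]
  have hbest : ∀ j, j ≠ 0 → μ j < μ 0 := fun j hj => by
    simp only [hμ, hj, if_true, if_false]; linarith
  have hbound := two_point_bound hμ'j c T π hΔ.le {d | d.2 ≠ true}
    (fun d hd => by
      have hd' : d.2 ≠ true := hd
      rw [roundRegret, if_neg hd']
      linarith [hμlt d.1, le_max_right (bestMean μ) c])
    (fun d hd => by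
      have hd' : d.2 = true := not_not.1 hd
      rw [roundRegret, if_pos hd', bestMean_eq hbest', hμ'i]
      linarith [le_max_left (c + Δ) c])
  -- Arm `i` rises by at most `3 * Δ`, from no lower than `c - 2 * Δ` to `c + Δ`; `i` may be `0`.
  have hkl : (μ' i - μ i) ^ 2 / 2 * expPulls (π c T) μ T i ≤ 9 / 2 := by
    have h1 : (μ' i - μ i) ^ 2 ≤ (3 * Δ) ^ 2 := by
      rw [hμ'i]
      exact pow_le_pow_left₀ (by linarith [hμlt i]) (by linarith [hμgt i]) 2
    calc (μ' i - μ i) ^ 2 / 2 * expPulls (π c T) μ T i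
        ≤ (μ' i - μ i) ^ 2 / 2 * (T / K) := mul_le_mul_of_nonneg_left hi (by positivity)
      _ ≤ (3 * Δ) ^ 2 / 2 * (T / K) :=
          mul_le_mul_of_nonneg_right (by linarith) (div_pos hT hK).le
      _ = 9 / 2 := by rw [mul_pow, hΔsq]; field_simp; norm_num
  have hexp : Real.exp (-(9 / 2)) ≤
      Real.exp (-((μ' i - μ i) ^ 2 / 2 * expPulls (π c T) μ T i)) :=
    Real.exp_le_exp.2 (neg_le_neg hkl)
  have hmain : 2 * (Real.exp (-(9 / 2)) / 8 * √((K : ℝ) * T)) ≤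
      regretRW μ c T π + regretRW μ' c T π := by
    refine le_trans ?_ hbound
    rw [hΔT]
    have := mul_le_mul_of_nonneg_left hexp (Real.sqrt_nonneg ((K : ℝ) * T))
    linarith
  by_cases hcase : Real.exp (-(9 / 2)) / 8 * √((K : ℝ) * T) ≤ regretRW μ c T π
  · refine ⟨μ, ⟨0, hbest⟩, fun j => abs_le.2 ⟨?_, ?_⟩, hcase⟩
    · linarith [hμgt j]
    · linarith [hμlt j]
  · refine ⟨μ', ⟨i, hbest'⟩, fun j => ?_, by linarith⟩
    by_cases hj : j = i
    · rw [hj, hμ'i, add_sub_cancel_left, abs_of_pos hΔ]; linarith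
    · rw [hμ'j j hj, abs_le]
      exact ⟨by linarith [hμgt j], by linarith [hμlt j]⟩

/-! ### Asymptotic bound. -/

/-- Consistency forces logarithmically many pulls of every suboptimal arm. -/
theorem eventually_le_expPulls {μ : Fin K → ℝ} {b : Fin K} (hb : ∀ j, j ≠ b → μ j < μ b) {c : ℝ}
    (hc : c < μ b) {π : Algorithm K} (hπ : IsConsistentRW π) {i : Fin K} (hi : i ≠ b) {r : ℝ}
    (hr : r * ((μ b - μ i) ^ 2 / 2) < 1) :
    ∀ᶠ T : ℕ in atTop, r * Real.log T ≤ expPulls (π c T) μ T i := by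
  obtain ⟨ε, hε, hrε⟩ : ∃ ε : ℝ, 0 < ε ∧ r * ((μ b + ε - μ i) ^ 2 / 2) < 1 := by
    have hcont : Continuous fun ε : ℝ => r * ((μ b + ε - μ i) ^ 2 / 2) := by fun_prop
    have h0 : ∀ᶠ ε in nhds (0 : ℝ), r * ((μ b + ε - μ i) ^ 2 / 2) < 1 :=
      hcont.continuousAt.eventually_lt continuousAt_const (by simpa using hr)
    obtain ⟨ε, h1, h2⟩ := ((h0.filter_mono nhdsWithin_le_nhds).and
      (self_mem_nhdsWithin : Set.Ioi (0 : ℝ) ∈ nhdsWithin 0 (Set.Ioi 0))).exists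
    exact ⟨ε, h2, h1⟩
  set μ' : Fin K → ℝ := Function.update μ i (μ b + ε) with hμ'
  have hμ'i : μ' i = μ b + ε := Function.update_self ..
  have hμ'j : ∀ j, j ≠ i → μ' j = μ j := fun j hj => Function.update_of_ne hj ..
  have hle : ∀ j, μ j ≤ μ b := fun j => by rw [← bestMean_eq hb]; exact le_bestMean μ j
  have hbest' : ∀ j, j ≠ i → μ' j < μ' i := fun j hj => by
    rw [hμ'j j hj, hμ'i]; linarith [hle j]
  -- Since `c < μ b`, only `(b, false)` is free under `μ`, and it costs at least `ε` under `μ'`.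
  -- Finiteness of the decisions gives a positive minimum.
  obtain ⟨δ, hδ, hS, hS'⟩ : ∃ δ : ℝ, 0 < δ ∧ (∀ d ∈ {d | d ≠ (b, false)}, δ ≤ roundRegret μ c d) ∧
      ∀ d ∉ {d | d ≠ (b, false)}, δ ≤ roundRegret μ' c d := by
    obtain ⟨d₀, hd₀, hmin⟩ := Set.exists_min_image {d : Fin K × Bool | d ≠ (b, false)}
      (roundRegret μ c) (Set.toFinite _) ⟨(b, true), by simp⟩
    have hpos : 0 < roundRegret μ c d₀ := by
      rw [roundRegret, bestMean_eq hb, max_eq_left hc.le, sub_pos]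
      split_ifs with h
      · exact hc
      · refine hb _ fun h' => hd₀ ?_
        ext1
        · exact h'
        · simpa using h
    refine ⟨min (roundRegret μ c d₀) ε, lt_min hpos hε, fun d hd => (min_le_left _ _).trans
      (hmin d hd), fun d hd => (min_le_right _ _).trans ?_⟩
    have hd' : d = (b, false) := not_not.1 hd
    rw [hd', roundRegret, bestMean_eq hbest', hμ'i, if_neg (by simp), hμ'j b hi.symm]
    linarith [le_max_left (μ b + ε) c]
  set q : ℝ := (μ b + ε - μ i) ^ 2 / 2 with hq
  have hqpos : 0 < q := by
    have : 0 < μ b + ε - μ i := by linarith [hle i]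
    positivity
  -- With this exponent, `T ^ (1 - r * q)` is `T * exp (-(r * q * log T))`, directly comparable with
  -- the two-point bound. Two terms with factor `δ / 16` stay below `δ / 4`.
  have ha : 0 < 1 - r * q := by linarith
  have h1 := (hπ c μ ⟨b, hb⟩ _ ha).bound (show 0 < δ / 16 by positivity)
  have h2 := (hπ c μ' ⟨i, hbest'⟩ _ ha).bound (show 0 < δ / 16 by positivity)
  filter_upwards [h1, h2, eventually_gt_atTop 0] with T hT1 hT2 hT0
  have hTpos : (0 : ℝ) < T := Nat.cast_pos.2 hT0
  have hbound := two_point_bound hμ'j c T π hδ.le {d | d ≠ (b, false)} hS hS'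
  rw [hμ'i, ← hq] at hbound
  rw [Real.norm_of_nonneg (Real.rpow_nonneg hTpos.le _)] at hT1 hT2
  have hT1' := (Real.le_norm_self _).trans hT1
  have hT2' := (Real.le_norm_self _).trans hT2
  have hpow : (T : ℝ) ^ (1 - r * q) = T * Real.exp (-(r * q * Real.log T)) := by
    rw [Real.rpow_def_of_pos hTpos]
    nth_rw 2 [← Real.exp_log hTpos]
    rw [← Real.exp_add]; congr 1; ring
  rw [hpow] at hT1' hT2'
  have hexp : Real.exp (-(q * expPulls (π c T) μ T i)) ≤ Real.exp (-(r * q * Real.log T)) := by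
    have h3 : δ * T / 4 * Real.exp (-(q * expPulls (π c T) μ T i)) ≤
        δ * T / 4 * Real.exp (-(r * q * Real.log T)) := by
      have h4 : 0 < δ * T * Real.exp (-(r * q * Real.log T)) := by positivity
      linarith
    exact le_of_mul_le_mul_left h3 (by positivity)
  have h5 := Real.exp_le_exp.1 hexp
  have h6 : q * (r * Real.log T) ≤ q * expPulls (π c T) μ T i := by linarith
  exact le_of_mul_le_mul_left h6 hqpos

/-- The asymptotic instance-dependent lower bound. -/
theorem le_liminf_regretRW {μ : Fin K → ℝ} (hμ : μ ∈ Instances K) (c : ℝ) {π : Algorithm K}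
    (hπ : IsConsistentRW π) :
    ((2 * ∑ i with μ i < bestMean μ,
      (max (bestMean μ) c - max (μ i) c) / gap μ i ^ 2 : ℝ) : EReal) ≤
        liminf (fun T : ℕ => ((regretRW μ c T π / Real.log T : ℝ) : EReal)) atTop := by
  obtain ⟨b, hb⟩ := hμ
  have hbest := bestMean_eq hb
  rcases le_or_gt (μ b) c with hc | hc
  · have hzero : 2 * ∑ i with μ i < bestMean μ,
        (max (bestMean μ) c - max (μ i) c) / gap μ i ^ 2 = 0 := by
      rw [Finset.sum_eq_zero, mul_zero]
      intro i _
      rw [max_eq_right ((le_bestMean μ i).trans (hbest.trans_le hc)),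
        max_eq_right (hbest.trans_le hc), sub_self, zero_div]
    rw [hzero]
    refine le_liminf_of_le (by isBoundedDefault) (Eventually.of_forall fun T => ?_)
    exact EReal.coe_le_coe_iff.2 (div_nonneg (regretRW_nonneg μ c T π) (Real.log_natCast_nonneg T))
  · set L : ℝ := 2 * ∑ i with μ i < bestMean μ,
      (max (bestMean μ) c - max (μ i) c) / gap μ i ^ 2 with hL
    -- The pull bound holds only strictly below the critical rate, so the claim is proved for `θ *
    -- L` with `θ < 1`, and then `θ` tends to `1`.
    have hlim : Tendsto (fun θ : ℝ => ((θ * L : ℝ) : EReal)) (nhdsWithin 1 (Set.Iio 1))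
        (nhds (L : EReal)) := by
      refine (continuous_coe_real_ereal.tendsto L).comp ?_
      have : Tendsto (fun θ : ℝ => θ * L) (nhds 1) (nhds (1 * L)) :=
        (continuous_id.mul continuous_const).tendsto 1
      rw [one_mul] at this
      exact this.mono_left nhdsWithin_le_nhds
    refine le_of_tendsto hlim ?_
    filter_upwards [self_mem_nhdsWithin] with θ hθ
    have hθ1 : θ < 1 := hθ
    refine le_liminf_of_le (by isBoundedDefault) ?_
    have hall : ∀ᶠ T : ℕ in atTop, ∀ i ∈ Finset.univ.filter fun i => μ i < bestMean μ,
        θ * (2 / gap μ i ^ 2) * Real.log T ≤ expPulls (π c T) μ T i := by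
      rw [eventually_all_finset]
      intro i hi
      have hlt : μ i < bestMean μ := (Finset.mem_filter.1 hi).2
      have hg : 0 < gap μ i := sub_pos.2 hlt
      refine eventually_le_expPulls hb hc hπ (fun h => ?_) ?_
      · rw [h, hbest] at hlt; exact lt_irrefl _ hlt
      · have : μ b - μ i = gap μ i := by rw [gap, hbest]
        rw [this]
        have : θ * (2 / gap μ i ^ 2) * (gap μ i ^ 2 / 2) = θ := by field_simp
        rwa [this]
    filter_upwards [hall, eventually_gt_atTop 1] with T hT hT1
    have hlog : 0 < Real.log T := Real.log_pos (Nat.one_lt_cast.2 hT1)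
    refine EReal.coe_le_coe_iff.2 ((le_div_iff₀ hlog).2 ?_)
    refine le_trans ?_ (sum_expPulls_le_regretRW μ c T π)
    calc θ * L * Real.log T
        = ∑ i with μ i < bestMean μ, (max (bestMean μ) c - max (μ i) c) *
            (θ * (2 / gap μ i ^ 2) * Real.log T) := by
          rw [hL, Finset.mul_sum, Finset.mul_sum, Finset.sum_mul]
          exact Finset.sum_congr rfl fun i _ => by ring
      _ ≤ ∑ i with μ i < bestMean μ,
            (max (bestMean μ) c - max (μ i) c) * expPulls (π c T) μ T i :=
          Finset.sum_le_sum fun i hi =>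
            mul_le_mul_of_nonneg_left (hT i hi) (sub_max_nonneg μ c i)
      _ ≤ ∑ i, (max (bestMean μ) c - max (μ i) c) * expPulls (π c T) μ T i :=
          Finset.sum_le_sum_of_subset_of_nonneg (Finset.filter_subset _ _) fun i _ _ =>
            mul_nonneg (sub_max_nonneg μ c i)
              (expSum_nonneg _ _ _ fun d => by split_ifs <;> norm_num)

end Regret

end AbstentionBandit

theorem theorem4 :
    (∀ K : ℕ, 1 ≤ K → ∀ c : ℝ, ∀ μ ∈ AbstentionBandit.Instances K,
      ∀ π : AbstentionBandit.Algorithm K, AbstentionBandit.IsConsistentRW π →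
        ((2 * ∑ i with μ i < AbstentionBandit.bestMean μ,
            (max (AbstentionBandit.bestMean μ) c - max (μ i) c) / AbstentionBandit.gap μ i ^ 2 : ℝ)
              : EReal) ≤
          liminf (fun T : ℕ =>
            ((AbstentionBandit.regretRW μ c T π / Real.log T : ℝ) : EReal)) atTop) ∧
    (∃ α : ℝ, 0 < α ∧ ∀ K : ℕ, 1 ≤ K → ∀ c : ℝ, ∀ T : ℕ, K ≤ T →
      (((α * √((K : ℝ) * T) : ℝ) : EReal) ≤
          ⨅ π : AbstentionBandit.Algorithm K, ⨆ μ ∈ AbstentionBandit.Instances K,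
            ((AbstentionBandit.regretRW μ c T π : ℝ) : EReal)) ∧
      ∀ π : AbstentionBandit.Algorithm K, ∃ μ ∈ AbstentionBandit.Instances K,
        (∀ i, |μ i - c| ≤ 2) ∧
          α * √((K : ℝ) * T) ≤ AbstentionBandit.regretRW μ c T π) := by
  refine ⟨fun K _ c μ hμ π hπ => AbstentionBandit.le_liminf_regretRW hμ c hπ,
    Real.exp (-(9 / 2)) / 8, by positivity, fun K hK c T hKT => ?_⟩
  have : NeZero K := ⟨by lia⟩
  refine ⟨le_iInf fun π => ?_, AbstentionBandit.exists_le_regretRW c hKT⟩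
  obtain ⟨μ, hμ, -, h⟩ := AbstentionBandit.exists_le_regretRW c hKT π
  exact le_iSup₂_of_le μ hμ (EReal.coe_le_coe_iff.2 h)
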